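/- For a compact set $K\subset\mathbb{R}$ and $p\neq 0$ let $$V_p(K)=\begin{cases}\min_\mu\int_K\int_K|x-y|^{-p}\,d\mu(x)\,d\mu(y), & p>0,\\ \max_\mu\int_K\int_K|x-y|^{-p}\,d\mu(x)\,d\mu(y), & p<0,\end{cases}\qquad V_{\log}(K)=\min_\mu\int_K\int_K\log\frac1{|x-y|}\,d\mu(x)\,d\mu(y),$$ where $\mu$ ranges over the Borel probability measures on $K$. The Riesz $p$-capacity of $K$ is $$\operatorname{cap}_p(K)=\begin{cases}V_p(K)^{-1/p}, & p\neq 0,\\ \exp(-V_{\log}(K)), & p=0.\end{cases}$$ Let $p\le -1<q<1$. If $K\subset\mathbb{R}$ is compact and contains more than one point, then $0<\operatorname{cap}_p(K)<\infty$ and $\operatorname{cap}_q(K)<\infty$. Among the compact sets $K\subset\mathbb{R}$ that contain more than one point, the ratio $\operatorname{cap}_q(K)/\operatorname{cap}_p(K)$ is maximal if and only if $K$ is an interval. Equivalently, for every $q\in(-1,1)$ and every compact $K\subset\mathbb{R}$ that contains more than one point, $$\operatorname{cap}_q(K)\le\frac{\operatorname{cap}_q([-1,1])}{2}\operatorname{diam}(K),$$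 with equality if and only if $K$ is an interval (that is, $K=[a,b]$ for some $a<b$). -/

import Mathlib

open MeasureTheory

/-- `μ` is a (Borel) probability measure on the set `K ⊆ ℝ`, viewed as a measure on `ℝ` that gives
no mass to the complement of `K`. -/
def IsProbOn (K : Set ℝ) (μ : Measure ℝ) : Prop :=
  IsProbabilityMeasure μ ∧ μ Kᶜ = 0

/-- The Riesz energy `∬ |x - y|^{-p} dμ(x) dμ(y)` of a measure, for `p ≠ 0`. The power is taken in
`[0, ∞]`, so that on the diagonal the kernel is `∞` when `p > 0` and `0` when `p < 0`. -/
noncomputable def rieszMeasureEnergy (p : ℝ) (μ : Measure ℝ) : ENNReal :=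
  ∫⁻ x, ∫⁻ y, (ENNReal.ofReal |x - y|) ^ (-p) ∂μ ∂μ

open Classical in
/-- The Riesz `p`-energy `V_p(K)`, for `p ≠ 0`: the minimum over probability measures on `K` when
`p > 0`, the maximum when `p < 0`. For the empty set it is `∞`, respectively `0`. -/
noncomputable def rieszEnergy (p : ℝ) (K : Set ℝ) : ENNReal :=
  if 0 < p then ⨅ (μ : Measure ℝ) (_ : IsProbOn K μ), rieszMeasureEnergy p μ
  else ⨆ (μ : Measure ℝ) (_ : IsProbOn K μ), rieszMeasureEnergy p μ

/-- The logarithmic energy `∬ log (1 / |x - y|) dμ(x) dμ(y)` of a measure, as the integral of the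
positive part minus the integral of the negative part. Here `ENNReal.log 0 = -∞`, so the kernel is
`+∞` on the diagonal. For a probability measure on a bounded set the second integral is finite. -/
noncomputable def logMeasureEnergy (μ : Measure ℝ) : EReal :=
  ((∫⁻ x, ∫⁻ y, (-ENNReal.log (ENNReal.ofReal |x - y|)).toENNReal ∂μ ∂μ : ENNReal) : EReal) -
    ((∫⁻ x, ∫⁻ y, (ENNReal.log (ENNReal.ofReal |x - y|)).toENNReal ∂μ ∂μ : ENNReal) : EReal)

/-- The logarithmic energy `V_log(K)`: the minimum over probability measures on `K`
(`+∞` for the empty set). -/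
noncomputable def logEnergy (K : Set ℝ) : EReal :=
  ⨅ (μ : Measure ℝ) (_ : IsProbOn K μ), logMeasureEnergy μ

open Classical in
/-- The Riesz `p`-capacity of `K`, with values in `[0, ∞]`: it is `V_p(K)^{-1/p}` for `p ≠ 0` and
`exp (-V_log(K))` for `p = 0`. -/
noncomputable def rieszCap (p : ℝ) (K : Set ℝ) : ENNReal :=
  if p = 0 then EReal.exp (-logEnergy K) else rieszEnergy p K ^ (-1 / p)

open scoped ENNReal NNReal

/-! Capacity is translation invariant and scales linearly, so one may assume that the convex hull of
`K` is `[0, 1]`. For `p ≤ -1` the measure `(δ₀ + δ₁) / 2` is then optimal, so `cap_p` is a constant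
multiple of the diameter. Both claims thus reduce to `rieszCap_lt_of_ne`: filling the gaps of `K`
strictly increases `cap_q`.

For distances at most `1` the energy is governed by a nonnegative kernel `φ` that is strictly
decreasing, strictly convex and integrable: `r ^ (-q)`, `-log r`, or, for `-1 < q < 0`, `1 - r ^
(-q)`, which turns the maximum into a minimum. If filling the gaps gave nothing, a minimizer `μ` on
`K` would also minimize over `[0, 1]`. With `U` its potential and `V` its energy, the first
variation gives `∫ U dν ≥ V` for every probability measure `ν` of finite energy on `[0, 1]`, and `U
= V` `μ`-a.e. Across a gap the distance to each point carrying mass is affine, so strict convexity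
forces `U < V` there (`IsConvexKernel.potential_lt_of_notMem`). The uniform measure on an interval
in the gap has finite energy, a contradiction (`IsConvexKernel.iInf_energy_lt`). -/

/-- The mutual energy `∬ φ(|x - y|) dν(y) dμ(x)` of two measures for the kernel `φ`. -/
noncomputable def mutualEnergy (φ : ℝ → ℝ≥0∞) (μ ν : Measure ℝ) : ℝ≥0∞ :=
  ∫⁻ x, ∫⁻ y, φ |x - y| ∂ν ∂μ

/-! ### Bilinearity and the first variation of the energy -/

section Bilinear

variable {φ : ℝ → ℝ≥0∞} {μ ν : Measure ℝ}

theorem measurable_kernel (hφ : Measurable φ) :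
    Measurable (fun z : ℝ × ℝ => φ |z.1 - z.2|) :=
  hφ.comp (by fun_prop)

theorem measurable_potential (hφ : Measurable φ) (ν : Measure ℝ) [SFinite ν] :
    Measurable (fun x => ∫⁻ y, φ |x - y| ∂ν) :=
  (measurable_kernel hφ).lintegral_prod_right'

theorem mutualEnergy_comm (hφ : Measurable φ) (μ ν : Measure ℝ) [SFinite μ] [SFinite ν] :
    mutualEnergy φ μ ν = mutualEnergy φ ν μ := by
  unfold mutualEnergy
  rw [lintegral_lintegral_swap (measurable_kernel hφ).aemeasurable]
  simp_rw [abs_sub_comm]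

theorem mutualEnergy_combination (hφ : Measurable φ) (μ ν : Measure ℝ) [SFinite μ] [SFinite ν]
    (a t : ℝ≥0) :
    mutualEnergy φ (a • μ + t • ν) (a • μ + t • ν) =
      a ^ 2 * mutualEnergy φ μ μ + 2 * (a * t) * mutualEnergy φ μ ν
        + t ^ 2 * mutualEnergy φ ν ν := by
  have h1 : ∀ x, ∫⁻ y, φ |x - y| ∂(a • μ + t • ν) =
      a * (∫⁻ y, φ |x - y| ∂μ) + t * ∫⁻ y, φ |x - y| ∂ν := fun x => by
    rw [lintegral_add_measure, lintegral_smul_measure, lintegral_smul_measure]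
    simp [ENNReal.smul_def]
  have h2 : ∀ ρ : Measure ℝ, SFinite ρ → ∫⁻ x, (a * (∫⁻ y, φ |x - y| ∂μ)
      + t * ∫⁻ y, φ |x - y| ∂ν) ∂ρ = a * mutualEnergy φ ρ μ + t * mutualEnergy φ ρ ν := by
    intro ρ _
    rw [lintegral_add_left ((measurable_potential hφ μ).const_mul _),
      lintegral_const_mul _ (measurable_potential hφ μ),
      lintegral_const_mul _ (measurable_potential hφ ν)]
    rfl
  have h3 : mutualEnergy φ (a • μ + t • ν) (a • μ + t • ν) =
      a * (a * mutualEnergy φ μ μ + t * mutualEnergy φ μ ν)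
        + t * (a * mutualEnergy φ ν μ + t * mutualEnergy φ ν ν) := by
    rw [← h2 μ inferInstance, ← h2 ν inferInstance, mutualEnergy]
    simp_rw [h1]
    rw [lintegral_add_measure, lintegral_smul_measure, lintegral_smul_measure]
    simp [ENNReal.smul_def]
  rw [h3, mutualEnergy_comm hφ ν μ]
  ring

/-- If the mutual energy of `μ` and `ν` is less than the energy of `μ`, then moving from `μ`
towards `ν` decreases the energy. -/
theorem exists_combination_energy_lt (hφ : Measurable φ) [SFinite μ] [SFinite ν]
    (hμ : mutualEnergy φ μ μ ≠ ⊤) (hν : mutualEnergy φ ν ν ≠ ⊤)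
    (h : mutualEnergy φ μ ν < mutualEnergy φ μ μ) :
    ∃ a t : ℝ≥0, a + t = 1 ∧
      mutualEnergy φ (a • μ + t • ν) (a • μ + t • ν) < mutualEnergy φ μ μ := by
  simp_rw [mutualEnergy_combination hφ]
  have hB := (h.trans_le le_top).ne
  lift mutualEnergy φ μ μ to ℝ≥0 using hμ with A
  lift mutualEnergy φ ν ν to ℝ≥0 using hν with C
  lift mutualEnergy φ μ ν to ℝ≥0 using hB with B
  have hBA : (B : ℝ) < A := by exact_mod_cast h
  have hA0 : (0 : ℝ) ≤ A := A.2
  have hB0 : (0 : ℝ) ≤ B := B.2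
  have hC0 : (0 : ℝ) ≤ C := C.2
  -- The energy at `t` is `A - 2t(A - B) + t²(A + C - 2B)`. This `t` gives `t(A + C - 2B) ≤ A - B <
  -- 2(A - B)`; the `+ 1` keeps the denominator positive.
  obtain ⟨t, ht⟩ : ∃ t : ℝ, t = (A - B) / (A + C + 1) := ⟨_, rfl⟩
  have hpos : (0 : ℝ) < A + C + 1 := by positivity
  have ht0 : 0 < t := by rw [ht]; exact div_pos (by linarith) hpos
  have hmul : t * (A + C + 1) = A - B := by rw [ht]; field_simp
  have ht1 : t ≤ 1 := by rw [ht, div_le_one hpos]; linarith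
  obtain ⟨a, ha⟩ : ∃ a : ℝ≥0, (a : ℝ) = 1 - t := ⟨⟨1 - t, by linarith⟩, rfl⟩
  lift t to ℝ≥0 using ht0.le
  refine ⟨a, t, ?_, ?_⟩
  · rw [← NNReal.coe_inj]; push_cast; rw [ha]; ring
  · norm_cast
    rw [← NNReal.coe_lt_coe]
    push_cast
    rw [ha]
    have : (t : ℝ) * (t * (A + C - 2 * B)) < t * (2 * (A - B)) := by
      refine mul_lt_mul_of_pos_left ?_ ht0
      nlinarith [mul_nonneg ht0.le hB0]
    nlinarith

end Bilinear

theorem IsProbOn.mono {K L : Set ℝ} {μ : Measure ℝ} (h : IsProbOn K μ) (hKL : K ⊆ L) :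
    IsProbOn L μ :=
  ⟨h.1, measure_mono_null (Set.compl_subset_compl.2 hKL) h.2⟩

theorem IsProbOn.combination {K : Set ℝ} {μ ν : Measure ℝ} (hμ : IsProbOn K μ)
    (hν : IsProbOn K ν) {a t : ℝ≥0} (h : a + t = 1) : IsProbOn K (a • μ + t • ν) := by
  have := hμ.1
  have := hν.1
  refine ⟨⟨?_⟩, ?_⟩
  · simp only [Measure.coe_add, Measure.coe_nnreal_smul_apply, Pi.add_apply, measure_univ, mul_one]
    exact_mod_cast h
  · simp [hμ.2, hν.2]

/-! ### Existence of minimizers -/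

section Minimizer

/-- The integral of a continuous `[0, ∞]`-valued function is lower semicontinuous for the weak
topology on probability measures. -/
theorem lowerSemicontinuous_lintegral_probabilityMeasure {E : Type*} [TopologicalSpace E]
    [MeasurableSpace E] [OpensMeasurableSpace E] {f : E → ℝ≥0∞} (hf : Continuous f) :
    LowerSemicontinuous (fun μ : ProbabilityMeasure E => ∫⁻ x, f x ∂(μ : Measure E)) := by
  have hmin : ∀ M : ℕ, Continuous (fun x => (min (f x) M).toNNReal) := fun M =>
    ENNReal.continuousOn_toNNReal.comp_continuous (by fun_prop)
      fun x => by simp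
  have hcoe : ∀ (M : ℕ) x, ((min (f x) M).toNNReal : ℝ≥0∞) = min (f x) M := fun M x =>
    ENNReal.coe_toNNReal (by simp)
  -- Each truncation at height `M` is bounded and continuous, so its integral is weakly continuous;
  -- a supremum of continuous functions is lower semicontinuous.
  have key : ∀ μ : ProbabilityMeasure E, ∫⁻ x, f x ∂(μ : Measure E) =
      ⨆ M : ℕ, ∫⁻ x, ((min (f x) M).toNNReal : ℝ≥0∞) ∂(μ : Measure E) := by
    intro μ
    rw [← lintegral_iSup (fun M => (hmin M).measurable.coe_nnreal_ennreal)]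
    · congr 1 with x
      simp_rw [hcoe]
      rw [← inf_iSup_eq, ENNReal.iSup_natCast, inf_top_eq]
    · intro M N hMN x
      simp_rw [hcoe]
      exact min_le_min le_rfl (by exact_mod_cast hMN)
  simp_rw [key]
  refine lowerSemicontinuous_iSup fun M => Continuous.lowerSemicontinuous ?_
  let g : BoundedContinuousFunction E ℝ≥0 := BoundedContinuousFunction.mkOfBound
    ⟨_, hmin M⟩ M fun x y => by
      have h : ∀ z, (min (f z) M).toNNReal ≤ M := fun z => by
        rw [← ENNReal.coe_le_coe, hcoe]; exact (min_le_right _ _).trans (by simp)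
      rw [NNReal.dist_eq, abs_le]
      have h1 : ((min (f x) M).toNNReal : ℝ) ≤ M := by exact_mod_cast h x
      have h2 : ((min (f y) M).toNNReal : ℝ) ≤ M := by exact_mod_cast h y
      constructor <;> simp <;> linarith [NNReal.coe_nonneg (min (f x) M).toNNReal,
        NNReal.coe_nonneg (min (f y) M).toNNReal]
  exact ProbabilityMeasure.continuous_lintegral_boundedContinuousFunction g

/-- Direct method: the probability measures on the compact space `K` form a weakly compact space, `μ
↦ μ × μ` is continuous, and the energy is lower semicontinuous even where `φ` is infinite. -/
theorem exists_minimizer {φ : ℝ → ℝ≥0∞} (hφ : Continuous φ) {K : Set ℝ} (hK : IsCompact K)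
    (hne : K.Nonempty) :
    ∃ μ, IsProbOn K μ ∧ ∀ ν, IsProbOn K ν → mutualEnergy φ μ μ ≤ mutualEnergy φ ν ν := by
  have : CompactSpace K := isCompact_iff_compactSpace.1 hK
  have : Nonempty K := hne.to_subtype
  have : Nonempty (ProbabilityMeasure K) :=
    ⟨⟨Measure.dirac (Classical.arbitrary K), inferInstance⟩⟩
  have hm : MeasurableEmbedding ((↑) : K → ℝ) := .subtype_coe hK.measurableSet
  have hpush : ∀ μ : Measure K, SFinite μ → mutualEnergy φ (μ.map (↑)) (μ.map (↑)) =
      ∫⁻ z, φ |(z.1 : ℝ) - z.2| ∂(μ.prod μ) := by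
    intro μ _
    have hc : Continuous (fun z : K × K => φ |(z.1 : ℝ) - z.2|) := hφ.comp (by fun_prop)
    rw [lintegral_prod _ hc.measurable.aemeasurable, mutualEnergy,
      hm.lintegral_map]
    simp_rw [hm.lintegral_map]
  have hlsc : LowerSemicontinuous (fun μ : ProbabilityMeasure K =>
      ∫⁻ z, φ |(z.1 : ℝ) - z.2| ∂((μ.prod μ : ProbabilityMeasure (K × K)) : Measure (K × K))) :=
    (lowerSemicontinuous_lintegral_probabilityMeasure
      (f := fun z : K × K => φ |(z.1 : ℝ) - z.2|) (hφ.comp (by fun_prop))).comp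
      (ProbabilityMeasure.continuous_prod.comp (continuous_id.prodMk continuous_id))
  obtain ⟨μ, -, hμ⟩ := (hlsc.lowerSemicontinuousOn Set.univ).exists_isMinOn
    (Set.univ_nonempty) isCompact_univ
  refine ⟨(μ : Measure K).map (↑), ⟨Measure.isProbabilityMeasure_map hm.measurable.aemeasurable,
    ?_⟩, fun ν hν => ?_⟩
  · rw [hm.map_apply]; simp
  · have := hν.1
    have hrestr : ν.restrict K = ν := Measure.restrict_eq_self_of_ae_mem (by
      rw [ae_iff]; exact hν.2)
    have hmap : (ν.comap ((↑) : K → ℝ)).map (↑) = ν := by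
      rw [map_comap_subtype_coe hK.measurableSet, hrestr]
    have hprob : IsProbabilityMeasure (ν.comap ((↑) : K → ℝ)) := ⟨by
      have h := congrArg (fun m : Measure ℝ => m Set.univ) hmap
      simp only [measure_univ] at h
      rwa [hm.map_apply, Set.preimage_univ] at h⟩
    have h := hμ (Set.mem_univ (⟨_, hprob⟩ : ProbabilityMeasure K))
    rw [← hmap, hpush _ inferInstance, hpush _ inferInstance]
    exact h

end Minimizer

/-! ### Strictly convex kernels and the gap argument -/

/-- The kernels on `[0, 1]` considered below: continuous with values in `[0, ∞]`, strictly
decreasing, strictly convex, and integrable. -/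
structure IsConvexKernel (φ : ℝ → ℝ≥0∞) : Prop where
  continuous : Continuous φ
  strictAntiOn : StrictAntiOn φ (Set.Icc 0 1)
  convex : ∀ r ∈ Set.Icc (0 : ℝ) 1, ∀ s ∈ Set.Icc (0 : ℝ) 1, r < s → ∀ a t : ℝ, 0 < a → 0 < t →
    a + t = 1 → φ (a * r + t * s) < ENNReal.ofReal a * φ r + ENNReal.ofReal t * φ s
  lintegral_ne_top : ∫⁻ r in Set.Icc 0 1, φ r ≠ ⊤

/-- By Fatou's lemma the potential is lower semicontinuous. Closedness provides nearest points in
the gap argument. -/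
theorem isClosed_potential_le {φ : ℝ → ℝ≥0∞} (hφ : Continuous φ) (μ : Measure ℝ) (V : ℝ≥0∞) :
    IsClosed {x | ∫⁻ y, φ |x - y| ∂μ ≤ V} := by
  refine IsSeqClosed.isClosed fun x a hx ha => ?_
  have hlim : ∀ y, Filter.liminf (fun n => φ |x n - y|) Filter.atTop = φ |a - y| := fun y =>
    Filter.Tendsto.liminf_eq ((hφ.tendsto _).comp (ha.sub_const y).abs)
  calc ∫⁻ y, φ |a - y| ∂μ = ∫⁻ y, Filter.liminf (fun n => φ |x n - y|) Filter.atTop ∂μ := by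
        simp_rw [hlim]
    _ ≤ Filter.liminf (fun n => ∫⁻ y, φ |x n - y| ∂μ) Filter.atTop :=
        lintegral_liminf_le fun n => (hφ.comp (by fun_prop)).measurable
    _ ≤ V := Filter.liminf_le_of_frequently_le' (Filter.Frequently.of_forall hx)

/-- Gives finite energy to normalized restrictions, which serve as competitors. -/
theorem mutualEnergy_le_of_le_smul {φ : ℝ → ℝ≥0∞} {μ ν : Measure ℝ} {c : ℝ≥0∞} (hc : c ≠ ⊤)
    (h : ν ≤ c • μ) : mutualEnergy φ ν ν ≤ c * (c * mutualEnergy φ μ μ) := by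
  have hin : ∀ f : ℝ → ℝ≥0∞, ∫⁻ x, f x ∂ν ≤ c * ∫⁻ x, f x ∂μ := fun f =>
    (lintegral_mono' h le_rfl).trans_eq (by rw [lintegral_smul_measure, smul_eq_mul])
  refine (hin _).trans ?_
  gcongr
  refine (lintegral_mono fun x => hin _).trans_eq ?_
  rw [lintegral_const_mul' _ _ hc]
  rfl

namespace IsConvexKernel

variable {φ : ℝ → ℝ≥0∞}

theorem convex_of_ne (h : IsConvexKernel φ) {r s a t : ℝ} (hr : r ∈ Set.Icc (0 : ℝ) 1)
    (hs : s ∈ Set.Icc (0 : ℝ) 1) (hne : r ≠ s) (ha : 0 < a) (ht : 0 < t) (hat : a + t = 1) :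
    φ (a * r + t * s) < ENNReal.ofReal a * φ r + ENNReal.ofReal t * φ s := by
  rcases hne.lt_or_gt with hlt | hlt
  · exact h.convex r hr s hs hlt a t ha ht hat
  · rw [add_comm (a * r), add_comm (ENNReal.ofReal a * _)]
    exact h.convex s hs r hr hlt t a ht ha (by rw [add_comm, hat])

/-- The potential of a measure carried by `F` is strictly smaller in the gaps of `F` than the
upper bound of the potential on `F`. -/
theorem potential_lt_of_notMem (h : IsConvexKernel φ) {μ : Measure ℝ} [IsProbabilityMeasure μ]
    {F : Set ℝ} (hF : IsCompact F) (hF01 : F ⊆ Set.Icc 0 1) (hμF : μ Fᶜ = 0) {V : ℝ≥0∞}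
    (hV : V ≠ ⊤) (hle : ∀ x ∈ F, ∫⁻ y, φ |x - y| ∂μ ≤ V) {x : ℝ} (hx : x ∈ Set.Icc (0 : ℝ) 1)
    (hxF : x ∉ F) : ∫⁻ y, φ |x - y| ∂μ < V := by
  have hae : ∀ᵐ y ∂μ, y ∈ F := by rw [ae_iff]; exact hμF
  have hmeas : ∀ c : ℝ, Measurable fun y => φ |c - y| := fun c =>
    (h.continuous.comp (by fun_prop)).measurable
  -- It suffices to find a strict pointwise majorant on `F` whose integral is at most `V`.
  have key : ∀ g : ℝ → ℝ≥0∞, Measurable g → ∫⁻ y, g y ∂μ ≤ V → (∀ y ∈ F, φ |x - y| < g y) →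
      ∫⁻ y, φ |x - y| ∂μ < V := by
    intro g hg hgV hlt
    have hlt' : ∀ᵐ y ∂μ, φ |x - y| < g y := hae.mono fun y hy => hlt y hy
    have hfin : ∫⁻ y, φ |x - y| ∂μ ≠ ⊤ :=
      (((lintegral_mono_ae (hlt'.mono fun y hy => hy.le)).trans hgV).trans_lt hV.lt_top).ne
    exact (lintegral_strict_mono (IsProbabilityMeasure.ne_zero μ) hg.aemeasurable hfin
      hlt').trans_le hgV
  by_cases hl : (F ∩ Set.Iic x).Nonempty <;> by_cases hr : (F ∩ Set.Ici x).Nonempty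
  -- The points `c` and `d` of `F` nearest to `x` bound a gap. Each `y ∈ F` lies on one side of it,
  -- so `|· - y|` is affine on `[c, d]` and strict convexity of `φ` applies.
  · obtain ⟨c, ⟨hcF, hcx⟩, hc⟩ := (hF.inter_right isClosed_Iic).exists_isGreatest hl
    obtain ⟨d, ⟨hdF, hdx⟩, hd⟩ := (hF.inter_right isClosed_Ici).exists_isLeast hr
    have hcx' : c < x := lt_of_le_of_ne hcx fun e => hxF (e ▸ hcF)
    have hdx' : x < d := lt_of_le_of_ne hdx fun e => hxF (e ▸ hdF)
    have hcd : 0 < d - c := by linarith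
    obtain ⟨a, rfl⟩ : ∃ a, x = a * c + (1 - a) * d := ⟨(d - x) / (d - c), by field_simp; ring⟩
    have ha0 : 0 < a := by nlinarith
    have ha1 : 0 < 1 - a := by nlinarith
    refine key (fun y => ENNReal.ofReal a * φ |c - y| + ENNReal.ofReal (1 - a) * φ |d - y|)
      (((hmeas c).const_mul _).add ((hmeas d).const_mul _)) ?_ fun y hy => ?_
    · rw [lintegral_add_left ((hmeas c).const_mul _), lintegral_const_mul _ (hmeas c),
        lintegral_const_mul _ (hmeas d)]
      calc _ ≤ ENNReal.ofReal a * V + ENNReal.ofReal (1 - a) * V := by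
            gcongr
            · exact hle c hcF
            · exact hle d hdF
        _ = V := by
            rw [← add_mul, ← ENNReal.ofReal_add ha0.le ha1.le]; simp
    · obtain ⟨hy0, hy1⟩ := hF01 hy
      obtain ⟨hc0, hc1⟩ := hF01 hcF
      obtain ⟨hd0, hd1⟩ := hF01 hdF
      rcases le_total y (a * c + (1 - a) * d) with hyx | hyx
      · have hyc : y ≤ c := hc ⟨hy, hyx⟩
        rw [abs_of_nonneg (by linarith : 0 ≤ a * c + (1 - a) * d - y),
          abs_of_nonneg (by linarith : 0 ≤ c - y), abs_of_nonneg (by linarith : 0 ≤ d - y)]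
        convert h.convex_of_ne (r := c - y) (s := d - y) ⟨by linarith, by linarith⟩
          ⟨by linarith, by linarith⟩ (by intro e; linarith) ha0 ha1 (by ring) using 2
        ring
      · have hyd : d ≤ y := hd ⟨hy, hyx⟩
        rw [abs_of_nonpos (by linarith : a * c + (1 - a) * d - y ≤ 0),
          abs_of_nonpos (by linarith : c - y ≤ 0), abs_of_nonpos (by linarith : d - y ≤ 0)]
        convert h.convex_of_ne (r := -(c - y)) (s := -(d - y)) ⟨by linarith, by linarith⟩
          ⟨by linarith, by linarith⟩ (by intro e; linarith) ha0 ha1 (by ring) using 2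
        ring
  -- Here `x` is to the right of `F`, and moving to `c` shortens all distances to `F`.
  · obtain ⟨c, ⟨hcF, hcx⟩, hc⟩ := (hF.inter_right isClosed_Iic).exists_isGreatest hl
    have hcx' : c < x := lt_of_le_of_ne hcx fun e => hxF (e ▸ hcF)
    refine key _ (hmeas c) (hle c hcF) fun y hy => ?_
    have hyx : y ≤ x := le_of_not_ge fun hxy => hr ⟨y, hy, hxy⟩
    have hyc : y ≤ c := hc ⟨hy, hyx⟩
    obtain ⟨hy0, hy1⟩ := hF01 hy
    obtain ⟨hc0, hc1⟩ := hF01 hcF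
    rw [abs_of_nonneg (by linarith : 0 ≤ x - y), abs_of_nonneg (by linarith : 0 ≤ c - y)]
    exact h.strictAntiOn ⟨by linarith, by linarith⟩ ⟨by linarith, by linarith [hx.2]⟩
      (by linarith)
  · obtain ⟨d, ⟨hdF, hdx⟩, hd⟩ := (hF.inter_right isClosed_Ici).exists_isLeast hr
    have hdx' : x < d := lt_of_le_of_ne hdx fun e => hxF (e ▸ hdF)
    refine key _ (hmeas d) (hle d hdF) fun y hy => ?_
    have hyx : x ≤ y := le_of_not_ge fun hxy => hl ⟨y, hy, hxy⟩
    have hyd : d ≤ y := hd ⟨hy, hyx⟩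
    obtain ⟨hy0, hy1⟩ := hF01 hy
    obtain ⟨hd0, hd1⟩ := hF01 hdF
    rw [abs_of_nonpos (by linarith : x - y ≤ 0), abs_of_nonpos (by linarith : d - y ≤ 0)]
    exact h.strictAntiOn ⟨by linarith, by linarith⟩ ⟨by linarith, by linarith [hx.1]⟩
      (by linarith)
  · exfalso
    obtain ⟨y, hy⟩ := hae.exists
    rcases le_total y x with hyx | hyx
    · exact hl ⟨y, hy, hyx⟩
    · exact hr ⟨y, hy, hyx⟩

theorem lintegral_abs_ne_top (h : IsConvexKernel φ) : ∫⁻ r in Set.Icc (-1) 1, φ |r| ≠ ⊤ := by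
  have hsub : Set.Icc (-1 : ℝ) 1 ⊆ Set.Icc (-1) 0 ∪ Set.Icc 0 1 := fun x hx => by
    rcases le_total x 0 with h0 | h0
    · exact .inl ⟨hx.1, h0⟩
    · exact .inr ⟨h0, hx.2⟩
  have hpos : ∫⁻ r in Set.Icc (0 : ℝ) 1, φ |r| = ∫⁻ r in Set.Icc 0 1, φ r :=
    setLIntegral_congr_fun measurableSet_Icc fun r hr => by rw [abs_of_nonneg hr.1]
  have hneg : ∫⁻ r in Set.Icc (-1 : ℝ) 0, φ |r| = ∫⁻ r in Set.Icc 0 1, φ r := by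
    rw [← hpos, ← (Measure.measurePreserving_neg volume).setLIntegral_comp_preimage_emb
      (MeasurableEquiv.neg ℝ).measurableEmbedding]
    simp
  refine ((lintegral_mono_set hsub).trans (lintegral_union_le _ _ _)).trans_lt ?_ |>.ne
  rw [hpos, hneg]
  exact ENNReal.add_lt_top.2 ⟨h.lintegral_ne_top.lt_top, h.lintegral_ne_top.lt_top⟩

/-- The normalized Lebesgue measure on a subinterval of `[0, 1]` has finite energy. -/
theorem uniform_energy_ne_top (h : IsConvexKernel φ) {u v : ℝ} (hu : 0 ≤ u) (huv : u < v)
    (hv : v ≤ 1) : mutualEnergy φ (ProbabilityTheory.cond volume (Set.Icc u v))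
      (ProbabilityTheory.cond volume (Set.Icc u v)) ≠ ⊤ := by
  have hc : (volume (Set.Icc u v))⁻¹ ≠ ⊤ := by simp [huv]
  refine (mutualEnergy_le_of_le_smul hc (μ := volume.restrict (Set.Icc u v)) le_rfl).trans_lt
    (ENNReal.mul_lt_top hc.lt_top (ENNReal.mul_lt_top hc.lt_top ?_)) |>.ne
  have hin : ∀ x ∈ Set.Icc u v, ∫⁻ y in Set.Icc u v, φ |x - y| ≤
      ∫⁻ r in Set.Icc (-1) 1, φ |r| := by
    intro x hx
    rw [← (Measure.measurePreserving_sub_left volume x).setLIntegral_comp_preimage_emb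
      (MeasurableEquiv.subLeft x).measurableEmbedding]
    simp only [sub_sub_cancel]
    refine lintegral_mono_set fun y (hy : x - y ∈ Set.Icc u v) => ?_
    exact ⟨by linarith [hx.1, hy.2], by linarith [hx.2, hy.1]⟩
  calc mutualEnergy φ (volume.restrict (Set.Icc u v)) (volume.restrict (Set.Icc u v))
      ≤ ∫⁻ _ in Set.Icc u v, ∫⁻ r in Set.Icc (-1) 1, φ |r| :=
        setLIntegral_mono measurable_const hin
    _ < ⊤ := by
        rw [setLIntegral_const]
        exact ENNReal.mul_lt_top h.lintegral_abs_ne_top.lt_top (by simp)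

theorem isProbOn_uniform {u v : ℝ} (huv : u < v) :
    IsProbOn (Set.Icc u v) (ProbabilityTheory.cond volume (Set.Icc u v)) := by
  refine ⟨ProbabilityTheory.cond_isProbabilityMeasure_of_finite (by simp [huv]) (by simp), ?_⟩
  have h := ProbabilityTheory.ae_cond_mem (μ := (volume : Measure ℝ))
    (measurableSet_Icc (a := u) (b := v))
  rwa [ae_iff] at h

/-- A compact proper subset of `[0, 1]` has strictly larger minimal energy than `[0, 1]`. -/
theorem iInf_energy_lt (h : IsConvexKernel φ) {K : Set ℝ} (hK : IsCompact K)
    (hK01 : K ⊆ Set.Icc 0 1) (h0 : 0 ∈ K) (h1 : 1 ∈ K) (hne : K ≠ Set.Icc 0 1) :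
    ⨅ (μ : Measure ℝ) (_ : IsProbOn (Set.Icc 0 1) μ), mutualEnergy φ μ μ <
      ⨅ (μ : Measure ℝ) (_ : IsProbOn K μ), mutualEnergy φ μ μ := by
  have hφm := h.continuous.measurable
  by_contra! hcon
  obtain ⟨μ, hμ, hμmin⟩ := exists_minimizer h.continuous hK ⟨0, h0⟩
  have hprob := hμ.1
  have hmin : ∀ ν, IsProbOn (Set.Icc 0 1) ν → mutualEnergy φ μ μ ≤ mutualEnergy φ ν ν := by
    intro ν hν
    exact (le_iInf₂ hμmin).trans (hcon.trans (iInf₂_le ν hν))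
  have hfin : mutualEnergy φ μ μ ≠ ⊤ :=
    ((hmin _ (isProbOn_uniform one_pos)).trans_lt
      (h.uniform_energy_ne_top le_rfl one_pos le_rfl).lt_top).ne
  -- First variation: otherwise a small step from `μ` towards `ν` would lower the energy.
  have hvar : ∀ ν, IsProbOn (Set.Icc 0 1) ν → mutualEnergy φ ν ν ≠ ⊤ →
      mutualEnergy φ μ μ ≤ ∫⁻ x, ∫⁻ y, φ |x - y| ∂μ ∂ν := by
    intro ν hν hνfin
    have := hν.1
    by_contra! hlt
    obtain ⟨a, t, hat, hlt'⟩ := exists_combination_energy_lt hφm hfin hνfin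
      (by rw [mutualEnergy_comm hφm]; exact hlt)
    exact hlt'.not_ge (hmin _ ((hμ.mono hK01).combination hν hat))
  have hUm := measurable_potential hφm μ
  have hint : ∀ ν : Measure ℝ, IsProbabilityMeasure ν →
      (∀ᵐ x ∂ν, ∫⁻ y, φ |x - y| ∂μ < mutualEnergy φ μ μ) →
      ∫⁻ x, ∫⁻ y, φ |x - y| ∂μ ∂ν < mutualEnergy φ μ μ := by
    intro ν _ hν
    have hle : ∫⁻ x, ∫⁻ y, φ |x - y| ∂μ ∂ν ≤ mutualEnergy φ μ μ :=
      (lintegral_mono_ae (hν.mono fun x hx => hx.le)).trans_eq (by simp)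
    refine (lintegral_strict_mono (IsProbabilityMeasure.ne_zero ν) aemeasurable_const
      (hle.trans_lt hfin.lt_top).ne hν).trans_eq (by simp)
  -- If the potential were below the energy on a set of positive measure, `μ` conditioned on that
  -- set would violate `hvar`.
  have hge : ∀ᵐ x ∂μ, mutualEnergy φ μ μ ≤ ∫⁻ y, φ |x - y| ∂μ := by
    rw [ae_iff]
    by_contra hpos
    set E := {x | ¬ mutualEnergy φ μ μ ≤ ∫⁻ y, φ |x - y| ∂μ} with hE
    have hEm : MeasurableSet E := by
      simp only [hE, not_le]
      exact measurableSet_lt hUm measurable_const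
    have hνprob : IsProbabilityMeasure (ProbabilityTheory.cond μ E) :=
      ProbabilityTheory.cond_isProbabilityMeasure hpos
    have hνle : ProbabilityTheory.cond μ E ≤ (μ E)⁻¹ • μ := by
      unfold ProbabilityTheory.cond
      gcongr
      exact Measure.restrict_le_self
    have hc : (μ E)⁻¹ ≠ ⊤ := by simpa using hpos
    refine (hint (ProbabilityTheory.cond μ E) hνprob ?_).not_ge (hvar _ ⟨hνprob, ?_⟩ ?_)
    · exact (ProbabilityTheory.ae_cond_mem hEm).mono fun x hx => not_le.1 hx
    · exact ProbabilityTheory.cond_absolutelyContinuous (hμ.mono hK01).2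
    · exact ((mutualEnergy_le_of_le_smul hc hνle).trans_lt
        (ENNReal.mul_lt_top hc.lt_top (ENNReal.mul_lt_top hc.lt_top hfin.lt_top))).ne
  -- The potential is at least its `μ`-average almost everywhere, hence equal to it.
  have heq : ∀ᵐ x ∂μ, mutualEnergy φ μ μ = ∫⁻ y, φ |x - y| ∂μ :=
    ae_eq_of_ae_le_of_lintegral_le hge (by simpa using hfin) hUm.aemeasurable
      (by simp only [lintegral_const, measure_univ, mul_one]; exact le_rfl)
  obtain ⟨x, ⟨hx0, hx1⟩, hxK⟩ := Set.exists_of_ssubset (hK01.ssubset_of_ne hne)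
  have hx0' : 0 < x := hx0.lt_of_ne fun e => hxK (e ▸ h0)
  have hx1' : x < 1 := hx1.lt_of_ne fun e => hxK (e ▸ h1)
  obtain ⟨ε, hε, hball⟩ := Metric.isOpen_iff.1
    (hK.isClosed.isOpen_compl.inter (isOpen_Ioo (a := (0 : ℝ)) (b := 1))) x ⟨hxK, hx0', hx1'⟩
  have hsub : Set.Icc x (x + ε / 2) ⊆ Kᶜ ∩ Set.Ioo 0 1 := fun y hy => hball (by
    rw [Metric.mem_ball, Real.dist_eq, abs_of_nonneg (by linarith [hy.1])]
    linarith [hy.2])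
  have hlt : x < x + ε / 2 := by linarith
  have hv : x + ε / 2 ≤ 1 := (hsub ⟨hlt.le, le_rfl⟩).2.2.le
  have hν := isProbOn_uniform hlt
  have hνprob := hν.1
  refine (hint _ hνprob ?_).not_ge (hvar _ (hν.mono (Set.Icc_subset_Icc hx0 hv))
    (h.uniform_energy_ne_top hx0 hlt hv))
  refine (ProbabilityTheory.ae_cond_mem measurableSet_Icc).mono fun z hz => ?_
  -- The potential bound may fail on a null subset of `K`. Discarding it leaves a compact set of
  -- full measure that still avoids the gap.
  have hF : IsCompact (K ∩ {x | ∫⁻ y, φ |x - y| ∂μ ≤ mutualEnergy φ μ μ}) :=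
    hK.inter_right (isClosed_potential_le h.continuous μ _)
  refine h.potential_lt_of_notMem hF (Set.inter_subset_left.trans hK01) ?_ hfin
    (fun y hy => hy.2) (Set.Ioo_subset_Icc_self (hsub hz).2) fun hzF => (hsub hz).1 hzF.1
  rw [Set.compl_inter]
  exact measure_union_null hμ.2 (by
    have := heq.mono fun y hy => hy.ge
    rwa [ae_iff] at this)

end IsConvexKernel

/-! ### The three kernels -/

/-- A kernel given on `(0, 1]` by a real function `f`, whose value at `0` is either `∞` or also
given by `f`, is convex in the sense of `IsConvexKernel` if `f` is. -/
theorem IsConvexKernel.of_real {φ : ℝ → ℝ≥0∞} {f : ℝ → ℝ} {S : Set ℝ} (hc : Continuous φ)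
    (hS : Set.Ioc 0 1 ⊆ S) (hφ : ∀ r ∈ S, φ r = ENNReal.ofReal (f r))
    (htop : 0 ∉ S → φ 0 = ⊤) (hf1 : 0 ≤ f 1) (hanti : StrictAntiOn f S)
    (hconv : StrictConvexOn ℝ S f) (hint : IntervalIntegrable f volume 0 1) :
    IsConvexKernel φ := by
  have hnn : ∀ r ∈ Set.Ioc (0 : ℝ) 1, 0 ≤ f r := fun r hr =>
    hf1.trans (hanti.antitoneOn (hS hr) (hS ⟨one_pos, le_rfl⟩) hr.2)
  refine ⟨hc, fun r hr s hs hrs => ?_, fun r hr s hs hrs a t ha ht hat => ?_, ?_⟩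
  · have hs' : s ∈ Set.Ioc (0 : ℝ) 1 := ⟨hr.1.trans_lt hrs, hs.2⟩
    rw [hφ s (hS hs')]
    by_cases hrS : r ∈ S
    · have := hanti hrS (hS hs') hrs
      rw [hφ r hrS, ENNReal.ofReal_lt_ofReal_iff ((hnn s hs').trans_lt this)]
      exact this
    · have : r = 0 := by
        by_contra hne
        exact hrS (hS ⟨lt_of_le_of_ne hr.1 (Ne.symm hne), hr.2⟩)
      subst this
      rw [htop hrS]
      exact ENNReal.ofReal_lt_top
  · have hs' : s ∈ Set.Ioc (0 : ℝ) 1 := ⟨hr.1.trans_lt hrs, hs.2⟩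
    have hm : a * r + t * s ∈ Set.Ioc (0 : ℝ) 1 :=
      ⟨by nlinarith [mul_nonneg ha.le hr.1, mul_pos ht hs'.1], by nlinarith [hr.2, hs.2]⟩
    rw [hφ _ (hS hm), hφ s (hS hs')]
    by_cases hrS : r ∈ S
    · have := hconv.2 hrS (hS hs') hrs.ne ha ht hat
      simp only [smul_eq_mul] at this
      have hfr : 0 ≤ f r := (hnn s hs').trans (hanti hrS (hS hs') hrs).le
      rw [hφ r hrS, ← ENNReal.ofReal_mul ha.le, ← ENNReal.ofReal_mul ht.le,
        ← ENNReal.ofReal_add (mul_nonneg ha.le hfr) (mul_nonneg ht.le (hnn s hs')),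
        ENNReal.ofReal_lt_ofReal_iff ((hnn _ hm).trans_lt this)]
      exact this
    · have : r = 0 := by
        by_contra hne
        exact hrS (hS ⟨lt_of_le_of_ne hr.1 (Ne.symm hne), hr.2⟩)
      subst this
      rw [htop hrS, ENNReal.mul_top (by simpa using ha), top_add]
      exact ENNReal.ofReal_lt_top
  · rw [setLIntegral_congr Ioc_ae_eq_Icc.symm,
      setLIntegral_congr_fun measurableSet_Ioc fun r hr => hφ r (hS hr)]
    exact ((intervalIntegrable_iff_integrableOn_Ioc_of_le zero_le_one).1 hint).lintegral_lt_top.ne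

/-- Write `r ^ (-q) = exp (-q log r)`: `-q log r` is strictly convex and `exp` is increasing and
convex. Integrability at `0` needs `q < 1`. -/
theorem isConvexKernel_rpow_neg {q : ℝ} (h0 : 0 < q) (h1 : q < 1) :
    IsConvexKernel (fun r => ENNReal.ofReal r ^ (-q)) := by
  have hlog : ∀ r ∈ Set.Ioc (0 : ℝ) 1, r ^ (-q) = Real.exp (-q * Real.log r) := fun r hr => by
    rw [Real.rpow_def_of_pos hr.1, mul_comm]
  refine .of_real (f := fun r => r ^ (-q)) (S := Set.Ioc 0 1)
    (ENNReal.continuous_rpow_const.comp ENNReal.continuous_ofReal) le_rfl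
    (fun r hr => ENNReal.ofReal_rpow_of_pos hr.1) (fun _ => ?_) (by simp) ?_ ?_ ?_
  · simp [h0]
  · intro r hr s hs hrs
    exact Real.rpow_lt_rpow_of_neg hr.1 hrs (neg_neg_of_pos h0)
  · refine ⟨convex_Ioc 0 1, fun r hr s hs hrs a t ha ht hat => ?_⟩
    have hm := convex_Ioc (0 : ℝ) 1 hr hs ha.le ht.le hat
    have h2 := strictConcaveOn_log_Ioi.2 (Set.mem_Ioi.2 hr.1) (Set.mem_Ioi.2 hs.1) hrs ha ht hat
    have h3 := convexOn_exp.2 (Set.mem_univ (-q * Real.log r)) (Set.mem_univ (-q * Real.log s))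
      ha.le ht.le hat
    simp only [smul_eq_mul] at *
    rw [hlog _ hm, hlog r hr, hlog s hs]
    exact (Real.exp_lt_exp.2 (by nlinarith)).trans_le h3
  · exact intervalIntegral.intervalIntegrable_rpow' (by linarith)

theorem toENNReal_neg_log_ofReal {r : ℝ} (hr : 0 < r) :
    (-ENNReal.log (ENNReal.ofReal r)).toENNReal = ENNReal.ofReal (-Real.log r) := by
  rw [ENNReal.log_ofReal_of_pos hr, ← EReal.coe_neg, EReal.real_coe_toENNReal]

theorem isConvexKernel_log :
    IsConvexKernel (fun r => (-ENNReal.log (ENNReal.ofReal r)).toENNReal) := by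
  refine .of_real (f := fun r => -Real.log r) (S := Set.Ioc 0 1) ?_ le_rfl
    (fun r hr => toENNReal_neg_log_ofReal hr.1) (fun _ => by simp) (by simp) ?_ ?_ ?_
  · exact (continuous_neg.comp
      (ENNReal.continuous_log.comp ENNReal.continuous_ofReal)).ereal_toENNReal
  · intro r hr s hs hrs
    exact neg_lt_neg (Real.log_lt_log hr.1 hrs)
  · exact (strictConcaveOn_log_Ioi.subset (fun x hx => hx.1) (convex_Ioc 0 1)).neg
  · exact intervalIntegral.intervalIntegrable_log'.neg

/-- Used with `s = -q`: `q > -1` makes `r ^ s` strictly concave. Truncated subtraction changes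
nothing for `r ≤ 1`. -/
theorem isConvexKernel_one_sub_rpow {s : ℝ} (h0 : 0 < s) (h1 : s < 1) :
    IsConvexKernel (fun r => 1 - ENNReal.ofReal r ^ s) := by
  refine .of_real (f := fun r => 1 - r ^ s) (S := Set.Ici 0) ?_
    (fun x hx => hx.1.le) ?_ (fun h => absurd Set.self_mem_Ici h) (by simp) ?_ ?_ ?_
  · exact (ENNReal.continuous_sub_left ENNReal.one_ne_top).comp
      (ENNReal.continuous_rpow_const.comp ENNReal.continuous_ofReal)
  · intro r hr
    rw [ENNReal.ofReal_sub _ (Real.rpow_nonneg hr s), ENNReal.ofReal_one,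
      ENNReal.ofReal_rpow_of_nonneg hr h0.le]
  · intro r hr t ht hrt
    exact sub_lt_sub_left (Real.rpow_lt_rpow hr hrt h0) 1
  · refine ⟨convex_Ici 0, fun r hr t ht hrt a b ha hb hab => ?_⟩
    have := (Real.strictConcaveOn_rpow h0 h1).2 hr ht hrt ha hb hab
    simp only [smul_eq_mul] at *
    nlinarith
  · exact intervalIntegrable_const.sub (intervalIntegral.intervalIntegrable_rpow' (by linarith))

/-! ### From energies of convex kernels to capacities -/

/-- Two points chosen independently from a measure on `[0, 1]` have distance at most `1`. -/
theorem IsProbOn.ae_ae_abs_sub_le {μ : Measure ℝ} (hμ : IsProbOn (Set.Icc 0 1) μ) :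
    ∀ᵐ x ∂μ, ∀ᵐ y ∂μ, |x - y| ≤ 1 := by
  have hae : ∀ᵐ y ∂μ, y ∈ Set.Icc (0 : ℝ) 1 := by rw [ae_iff]; exact hμ.2
  refine hae.mono fun x hx => hae.mono fun y hy => ?_
  rw [abs_le]
  constructor <;> linarith [hx.1, hx.2, hy.1, hy.2]

theorem lintegral_lintegral_congr_of_isProbOn {μ : Measure ℝ} (hμ : IsProbOn (Set.Icc 0 1) μ)
    {φ ψ : ℝ → ℝ≥0∞} (h : ∀ r, r ≤ 1 → φ r = ψ r) :
    mutualEnergy φ μ μ = mutualEnergy ψ μ μ :=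
  lintegral_congr_ae (hμ.ae_ae_abs_sub_le.mono fun _ hx =>
    lintegral_congr_ae (hx.mono fun _ hy => h _ hy))

theorem mutualEnergy_const {μ : Measure ℝ} [IsProbabilityMeasure μ] (c : ℝ≥0∞) :
    mutualEnergy (fun _ => c) μ μ = c := by
  simp [mutualEnergy]

theorem mutualEnergy_add {φ ψ : ℝ → ℝ≥0∞} (hφ : Measurable φ) (μ ν : Measure ℝ) [SFinite ν] :
    mutualEnergy (fun r => φ r + ψ r) μ ν = mutualEnergy φ μ ν + mutualEnergy ψ μ ν := by
  unfold mutualEnergy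
  rw [← lintegral_add_left (measurable_potential hφ ν)]
  exact lintegral_congr fun x => lintegral_add_left (hφ.comp (by fun_prop)) _

theorem logMeasureEnergy_of_isProbOn {μ : Measure ℝ} (hμ : IsProbOn (Set.Icc 0 1) μ) :
    logMeasureEnergy μ =
      (mutualEnergy (fun r => (-ENNReal.log (ENNReal.ofReal r)).toENNReal) μ μ : ℝ≥0∞) := by
  have h : mutualEnergy (fun r => (ENNReal.log (ENNReal.ofReal r)).toENNReal) μ μ = 0 := by
    have := hμ.1
    rw [lintegral_lintegral_congr_of_isProbOn hμ (ψ := fun _ => 0), mutualEnergy_const]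
    intro r hr
    rw [EReal.toENNReal_eq_zero_iff, ENNReal.log_le_zero_iff]
    simpa using hr
  unfold mutualEnergy at h
  rw [logMeasureEnergy, h]
  simp [mutualEnergy]

/-- On distances at most `1` the two kernels add up to `1`, and `μ × μ` has mass `1`. -/
theorem rieszMeasureEnergy_of_isProbOn {μ : Measure ℝ} (hμ : IsProbOn (Set.Icc 0 1) μ) {p : ℝ}
    (hp : p < 0) :
    rieszMeasureEnergy p μ = 1 - mutualEnergy (fun r => 1 - ENNReal.ofReal r ^ (-p)) μ μ := by
  have := hμ.1
  have hφ : Measurable (fun r : ℝ => ENNReal.ofReal r ^ (-p)) := by fun_prop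
  have hadd : mutualEnergy (fun r => ENNReal.ofReal r ^ (-p)) μ μ +
      mutualEnergy (fun r => 1 - ENNReal.ofReal r ^ (-p)) μ μ = 1 := by
    have h1 : mutualEnergy (fun r => ENNReal.ofReal r ^ (-p) + (1 - ENNReal.ofReal r ^ (-p))) μ μ
        = 1 := by
      rw [lintegral_lintegral_congr_of_isProbOn hμ (ψ := fun _ => 1), mutualEnergy_const]
      intro r hr
      exact add_tsub_cancel_of_le (ENNReal.rpow_le_one (by simpa using hr) (by linarith))
    rwa [mutualEnergy_add hφ] at h1
  refine ENNReal.eq_sub_of_add_eq ?_ hadd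
  exact ((le_add_left le_rfl).trans_eq hadd).trans_lt ENNReal.one_lt_top |>.ne

theorem IsProbOn.dirac {K : Set ℝ} (hK : MeasurableSet K) {x : ℝ} (hx : x ∈ K) :
    IsProbOn K (Measure.dirac x) :=
  ⟨inferInstance, by simp [hx, hK.compl]⟩

/-- The capacity of a compact proper subset of `[0, 1]` is smaller than that of `[0, 1]`. -/
theorem rieszCap_lt_of_ne {q : ℝ} (hq₁ : -1 < q) (hq₂ : q < 1) {K : Set ℝ} (hK : IsCompact K)
    (hK01 : K ⊆ Set.Icc 0 1) (h0 : 0 ∈ K) (h1 : 1 ∈ K) (hne : K ≠ Set.Icc 0 1) :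
    rieszCap q K < rieszCap q (Set.Icc 0 1) := by
  unfold rieszCap
  rcases lt_trichotomy q 0 with hq | rfl | hq
  · rw [if_neg hq.ne, if_neg hq.ne]
    refine ENNReal.rpow_lt_rpow ?_ (div_pos_of_neg_of_neg (by norm_num) hq)
    unfold rieszEnergy
    rw [if_neg hq.not_gt, if_neg hq.not_gt]
    have hlt := (isConvexKernel_one_sub_rpow (neg_pos.2 hq) (by linarith)).iInf_energy_lt
      hK hK01 h0 h1 hne
    -- A single `μ` on `[0, 1]` beating the infimum over `K` preserves strictness through `1 - ·`.
    obtain ⟨μ, hμ⟩ := iInf_lt_iff.1 hlt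
    obtain ⟨hμp, hμ⟩ := iInf_lt_iff.1 hμ
    set I := ⨅ (ν : Measure ℝ) (_ : IsProbOn K ν),
      mutualEnergy (fun r => 1 - ENNReal.ofReal r ^ (-q)) ν ν
    have hI : ∀ ν, IsProbOn K ν →
        I ≤ mutualEnergy (fun r => 1 - ENNReal.ofReal r ^ (-q)) ν ν := fun ν hν => iInf₂_le ν hν
    -- Truncated subtraction from `1` can be undone only below `1`.
    have hI1 : I ≤ 1 := by
      have hd := IsProbOn.dirac hK.measurableSet h0
      have := hd.1
      refine (hI _ hd).trans ((lintegral_mono fun x => lintegral_mono fun y =>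
        tsub_le_self).trans_eq (mutualEnergy_const 1))
    calc ⨆ (μ : Measure ℝ) (_ : IsProbOn K μ), rieszMeasureEnergy q μ ≤ 1 - I :=
        iSup₂_le fun ν hν => by
          rw [rieszMeasureEnergy_of_isProbOn (hν.mono hK01) hq]
          exact tsub_le_tsub_left (hI ν hν) _
      _ < 1 - mutualEnergy (fun r => 1 - ENNReal.ofReal r ^ (-q)) μ μ :=
        lt_of_not_ge fun hle => hμ.not_ge <| by
          rw [← ENNReal.sub_sub_cancel ENNReal.one_ne_top hI1,
            ← ENNReal.sub_sub_cancel ENNReal.one_ne_top (hμ.le.trans hI1)]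
          exact tsub_le_tsub_left hle 1
      _ = rieszMeasureEnergy q μ := (rieszMeasureEnergy_of_isProbOn hμp hq).symm
      _ ≤ _ := le_iSup₂ (f := fun (μ : Measure ℝ) (_ : IsProbOn (Set.Icc 0 1) μ) =>
          rieszMeasureEnergy q μ) μ hμp
  · rw [if_pos rfl, if_pos rfl, EReal.exp_lt_exp_iff, EReal.neg_lt_neg_iff]
    have hlt := isConvexKernel_log.iInf_energy_lt hK hK01 h0 h1 hne
    obtain ⟨μ, hμ⟩ := iInf_lt_iff.1 hlt
    obtain ⟨hμp, hμ⟩ := iInf_lt_iff.1 hμ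
    calc _ ≤ logMeasureEnergy μ := iInf₂_le μ hμp
      _ < _ := by
        rw [logMeasureEnergy_of_isProbOn hμp]
        exact EReal.coe_ennreal_lt_coe_ennreal_iff.2 hμ
      _ ≤ _ := le_iInf₂ fun ν hν => by
        rw [logMeasureEnergy_of_isProbOn (hν.mono hK01)]
        exact EReal.coe_ennreal_le_coe_ennreal_iff.2 (iInf₂_le ν hν)
  · rw [if_neg hq.ne', if_neg hq.ne']
    rw [neg_div, ENNReal.rpow_neg, ENNReal.rpow_neg, ENNReal.inv_lt_inv]
    refine ENNReal.rpow_lt_rpow ?_ (one_div_pos.2 hq)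
    unfold rieszEnergy
    rw [if_pos hq, if_pos hq]
    exact (isConvexKernel_rpow_neg hq hq₂).iInf_energy_lt hK hK01 h0 h1 hne

theorem rieszCap_Icc_zero_one_le_one (q : ℝ) : rieszCap q (Set.Icc 0 1) ≤ 1 := by
  unfold rieszCap
  rcases lt_trichotomy q 0 with hq | rfl | hq
  · rw [if_neg hq.ne, rieszEnergy, if_neg hq.not_gt]
    refine ENNReal.rpow_le_one (iSup₂_le fun μ hμ => ?_)
      (div_nonneg_of_nonpos (by norm_num) hq.le)
    rw [rieszMeasureEnergy_of_isProbOn hμ hq]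
    exact tsub_le_self
  · rw [if_pos rfl, ← EReal.exp_zero, EReal.exp_le_exp_iff, EReal.neg_le_zero]
    refine le_iInf₂ fun μ hμ => ?_
    rw [logMeasureEnergy_of_isProbOn hμ]
    exact EReal.coe_ennreal_nonneg _
  · rw [if_neg hq.ne', rieszEnergy, if_pos hq]
    refine ENNReal.rpow_le_one_of_one_le_of_neg (le_iInf₂ fun μ hμ => ?_)
      (div_neg_of_neg_of_pos (by norm_num) hq)
    have := hμ.1
    calc (1 : ℝ≥0∞) = mutualEnergy (fun _ => 1) μ μ := (mutualEnergy_const 1).symm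
      _ ≤ rieszMeasureEnergy q μ := lintegral_mono_ae (hμ.ae_ae_abs_sub_le.mono fun x hx =>
          lintegral_mono_ae (hx.mono fun y hy => by
            rw [ENNReal.rpow_neg, ENNReal.one_le_inv]
            exact ENNReal.rpow_le_one (by simpa using hy) hq.le))

/-! ### Behaviour under affine maps -/

section Affine

variable {c e : ℝ} (hc : 0 < c)

/-- The map `x ↦ c x + e` as a measurable equivalence. -/
noncomputable def affineMeasurableEquiv (c e : ℝ) (hc : 0 < c) : ℝ ≃ᵐ ℝ :=
  (affineHomeomorph c e hc.ne').toMeasurableEquiv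

theorem affineMeasurableEquiv_apply (x : ℝ) : affineMeasurableEquiv c e hc x = c * x + e := rfl

theorem mutualEnergy_map_affine (φ : ℝ → ℝ≥0∞) (ν : Measure ℝ) :
    mutualEnergy φ (ν.map (affineMeasurableEquiv c e hc)) (ν.map (affineMeasurableEquiv c e hc)) =
      mutualEnergy (fun r => φ (c * r)) ν ν := by
  unfold mutualEnergy
  simp_rw [lintegral_map_equiv, affineMeasurableEquiv_apply, add_sub_add_right_eq_sub, ← mul_sub,
    abs_mul, abs_of_pos hc]

theorem isProbOn_map_affine_iff {K : Set ℝ} {ν : Measure ℝ} :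
    IsProbOn (affineMeasurableEquiv c e hc '' K) (ν.map (affineMeasurableEquiv c e hc)) ↔
      IsProbOn K ν := by
  have h : ∀ s, ν.map (affineMeasurableEquiv c e hc) s = ν (affineMeasurableEquiv c e hc ⁻¹' s) :=
    fun s => (affineMeasurableEquiv c e hc).map_apply s
  unfold IsProbOn
  rw [isProbabilityMeasure_iff, isProbabilityMeasure_iff, h, h, Set.preimage_univ,
    Set.preimage_compl, Set.preimage_image_eq _ (affineMeasurableEquiv c e hc).injective]

theorem surjective_map_affine :
    Function.Surjective fun ν : Measure ℝ => ν.map (affineMeasurableEquiv c e hc) := fun μ =>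
  ⟨μ.map (affineMeasurableEquiv c e hc).symm, by simp⟩

theorem iInf_isProbOn_affine {α : Type*} [CompleteLattice α] (F : Measure ℝ → α) (K : Set ℝ) :
    ⨅ (μ : Measure ℝ) (_ : IsProbOn (affineMeasurableEquiv c e hc '' K) μ), F μ =
      ⨅ (ν : Measure ℝ) (_ : IsProbOn K ν), F (ν.map (affineMeasurableEquiv c e hc)) := by
  rw [← (surjective_map_affine (e := e) hc).iInf_comp]
  simp_rw [isProbOn_map_affine_iff]

theorem iSup_isProbOn_affine {α : Type*} [CompleteLattice α] (F : Measure ℝ → α) (K : Set ℝ) :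
    ⨆ (μ : Measure ℝ) (_ : IsProbOn (affineMeasurableEquiv c e hc '' K) μ), F μ =
      ⨆ (ν : Measure ℝ) (_ : IsProbOn K ν), F (ν.map (affineMeasurableEquiv c e hc)) :=
  -- A supremum is an infimum in the order dual.
  iInf_isProbOn_affine (α := αᵒᵈ) hc F K

theorem ofReal_rpow_ne_zero_ne_top {c : ℝ} (hc : 0 < c) (p : ℝ) :
    ENNReal.ofReal c ^ p ≠ 0 ∧ ENNReal.ofReal c ^ p ≠ ⊤ := by
  rw [ENNReal.ofReal_rpow_of_pos hc]
  exact ⟨by simpa using Real.rpow_pos_of_pos hc p, ENNReal.ofReal_ne_top⟩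

theorem mul_rpow_of_ne_zero_ne_top {a : ℝ≥0∞} (h0 : a ≠ 0) (ht : a ≠ ⊤) (x : ℝ≥0∞) (p : ℝ) :
    (a * x) ^ p = a ^ p * x ^ p := by
  rw [ENNReal.mul_rpow_eq_ite, if_neg (by simp [h0, ht])]

theorem rieszMeasureEnergy_map_affine (p : ℝ) (ν : Measure ℝ) :
    rieszMeasureEnergy p (ν.map (affineMeasurableEquiv c e hc)) =
      ENNReal.ofReal c ^ (-p) * rieszMeasureEnergy p ν := by
  have hk := (ofReal_rpow_ne_zero_ne_top hc (-p)).2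
  change mutualEnergy (fun r => ENNReal.ofReal r ^ (-p)) _ _ = _
  rw [mutualEnergy_map_affine]
  unfold mutualEnergy rieszMeasureEnergy
  simp_rw [ENNReal.ofReal_mul hc.le, mul_rpow_of_ne_zero_ne_top (ENNReal.ofReal_pos.2 hc).ne'
    ENNReal.ofReal_ne_top, lintegral_const_mul' _ _ hk]

theorem rieszEnergy_image_affine (p : ℝ) (K : Set ℝ) :
    rieszEnergy p (affineMeasurableEquiv c e hc '' K) =
      ENNReal.ofReal c ^ (-p) * rieszEnergy p K := by
  obtain ⟨h0, ht⟩ := ofReal_rpow_ne_zero_ne_top hc (-p)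
  unfold rieszEnergy
  split_ifs
  · rw [iInf_isProbOn_affine]
    simp_rw [rieszMeasureEnergy_map_affine, ENNReal.mul_iInf_of_ne h0 ht]
  · rw [iSup_isProbOn_affine]
    simp_rw [rieszMeasureEnergy_map_affine, ENNReal.mul_iSup]

theorem ofReal_neg_add_add_ofReal (a b : ℝ) :
    ENNReal.ofReal (-(a + b)) + ENNReal.ofReal b + ENNReal.ofReal a =
      ENNReal.ofReal (a + b) + ENNReal.ofReal (-b) + ENNReal.ofReal (-a) := by
  rw [← ENNReal.toReal_eq_toReal_iff' (by simp) (by simp)]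
  simp only [ENNReal.toReal_add, ENNReal.ofReal_ne_top, ne_eq, not_false_eq_true,
    ENNReal.add_eq_top, or_self, ENNReal.toReal_ofReal']
  linarith [max_zero_sub_max_neg_zero_eq_self a, max_zero_sub_max_neg_zero_eq_self b,
    max_zero_sub_max_neg_zero_eq_self (a + b)]

theorem toENNReal_log_ofReal {r : ℝ} (hr : 0 < r) :
    (ENNReal.log (ENNReal.ofReal r)).toENNReal = ENNReal.ofReal (Real.log r) := by
  rw [ENNReal.log_ofReal_of_pos hr, EReal.real_coe_toENNReal]

/-- This is `log (c r) = log c + log r` with positive and negative parts sorted so that no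
subtraction occurs; for `r ≤ 0` both sides are infinite. -/
theorem log_kernel_mul {c : ℝ} (hc : 0 < c) (r : ℝ) :
    (-ENNReal.log (ENNReal.ofReal (c * r))).toENNReal
        + (ENNReal.log (ENNReal.ofReal r)).toENNReal + ENNReal.ofReal (Real.log c) =
      (ENNReal.log (ENNReal.ofReal (c * r))).toENNReal
        + (-ENNReal.log (ENNReal.ofReal r)).toENNReal + ENNReal.ofReal (-Real.log c) := by
  rcases le_or_gt r 0 with hr | hr
  · rw [ENNReal.ofReal_of_nonpos hr,
      ENNReal.ofReal_of_nonpos (mul_nonpos_of_nonneg_of_nonpos hc.le hr)]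
    simp
  · have hcr := mul_pos hc hr
    rw [toENNReal_neg_log_ofReal hcr, toENNReal_neg_log_ofReal hr, toENNReal_log_ofReal hcr,
      toENNReal_log_ofReal hr, Real.log_mul hc.ne' hr.ne']
    exact ofReal_neg_add_add_ofReal _ _

/-- Excludes `∞ - ∞` in the logarithmic energy. -/
theorem mutualEnergy_posLog_ne_top {K : Set ℝ} (hK : IsCompact K) {μ : Measure ℝ}
    (hμ : IsProbOn K μ) :
    mutualEnergy (fun r => (ENNReal.log (ENNReal.ofReal r)).toENNReal) μ μ ≠ ⊤ := by
  have := hμ.1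
  have hae : ∀ᵐ y ∂μ, y ∈ K := by rw [ae_iff]; exact hμ.2
  obtain ⟨D, hD⟩ := Metric.isBounded_iff.1 hK.isBounded
  refine (lt_of_le_of_lt (b := (ENNReal.log (ENNReal.ofReal D)).toENNReal) ?_ ?_).ne
  · refine le_of_le_of_eq (lintegral_mono_ae (hae.mono fun x hx => lintegral_mono_ae
      (hae.mono fun y hy => ?_))) (mutualEnergy_const (μ := μ) _)
    exact EReal.toENNReal_le_toENNReal (ENNReal.log_monotone (ENNReal.ofReal_le_ofReal
      (hD hx hy)))
  · rw [lt_top_iff_ne_top, EReal.toENNReal_ne_top_iff, ne_eq, ENNReal.log_eq_top_iff]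
    exact ENNReal.ofReal_ne_top

theorem logMeasureEnergy_map_affine {K : Set ℝ} (hK : IsCompact K) {ν : Measure ℝ}
    (hν : IsProbOn K ν) :
    logMeasureEnergy (ν.map (affineMeasurableEquiv c e hc)) =
      logMeasureEnergy ν - (Real.log c : ℝ) := by
  have := hν.1
  have hm1 : Measurable fun r : ℝ => (ENNReal.log (ENNReal.ofReal r)).toENNReal := by
    fun_prop
  have hm2 : Measurable fun r : ℝ => (-ENNReal.log (ENNReal.ofReal r)).toENNReal :=
    isConvexKernel_log.continuous.measurable
  have hB := mutualEnergy_posLog_ne_top hK hν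
  have hB' := mutualEnergy_posLog_ne_top
    (hK.image (affineHomeomorph c e hc.ne').continuous) ((isProbOn_map_affine_iff (e := e) hc).2 hν)
  change ((mutualEnergy (fun r => (-ENNReal.log (ENNReal.ofReal r)).toENNReal) _ _ : ℝ≥0∞) : EReal)
    - ((mutualEnergy (fun r => (ENNReal.log (ENNReal.ofReal r)).toENNReal) _ _ : ℝ≥0∞) : EReal)
    = ((mutualEnergy (fun r => (-ENNReal.log (ENNReal.ofReal r)).toENNReal) _ _ : ℝ≥0∞) : EReal)
    - ((mutualEnergy (fun r => (ENNReal.log (ENNReal.ofReal r)).toENNReal) _ _ : ℝ≥0∞) : EReal)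
    - _
  rw [mutualEnergy_map_affine] at hB' ⊢
  rw [mutualEnergy_map_affine]
  have key : mutualEnergy (fun r => (-ENNReal.log (ENNReal.ofReal (c * r))).toENNReal) ν ν
      + mutualEnergy (fun r => (ENNReal.log (ENNReal.ofReal r)).toENNReal) ν ν
      + ENNReal.ofReal (Real.log c)
      = mutualEnergy (fun r => (ENNReal.log (ENNReal.ofReal (c * r))).toENNReal) ν ν
      + mutualEnergy (fun r => (-ENNReal.log (ENNReal.ofReal r)).toENNReal) ν ν
      + ENNReal.ofReal (-Real.log c) := by
    have hm1c : Measurable fun r : ℝ => (ENNReal.log (ENNReal.ofReal (c * r))).toENNReal :=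
      hm1.comp (measurable_const_mul c)
    have hm2c : Measurable fun r : ℝ => (-ENNReal.log (ENNReal.ofReal (c * r))).toENNReal :=
      hm2.comp (measurable_const_mul c)
    rw [← mutualEnergy_const (μ := ν) (ENNReal.ofReal (Real.log c)),
      ← mutualEnergy_const (μ := ν) (ENNReal.ofReal (-Real.log c)),
      ← mutualEnergy_add hm2c, ← mutualEnergy_add hm1c, ← mutualEnergy_add (by fun_prop),
      ← mutualEnergy_add (by fun_prop)]
    congr 1
    funext r
    exact log_kernel_mul hc r
  generalize mutualEnergy (fun r => (-ENNReal.log (ENNReal.ofReal (c * r))).toENNReal) ν ν = A'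
    at *
  generalize mutualEnergy (fun r => (-ENNReal.log (ENNReal.ofReal r)).toENNReal) ν ν = A at *
  generalize mutualEnergy (fun r => (ENNReal.log (ENNReal.ofReal (c * r))).toENNReal) ν ν = B'
    at *
  generalize mutualEnergy (fun r => (ENNReal.log (ENNReal.ofReal r)).toENNReal) ν ν = B at *
  lift B to ℝ≥0 using hB
  lift B' to ℝ≥0 using hB'
  -- All other terms of `key` are finite, so either both energies are infinite or `key` can be read
  -- in the reals.
  have htop : A' = ⊤ ↔ A = ⊤ := by
    constructor
    · rintro rfl
      by_contra hA
      have h : (B' : ℝ≥0∞) + A + ENNReal.ofReal (-Real.log c) ≠ ⊤ := by simp [hA]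
      exact h (by rw [← key]; simp)
    · rintro rfl
      by_contra hA
      have h : A' + (B : ℝ≥0∞) + ENNReal.ofReal (Real.log c) ≠ ⊤ := by simp [hA]
      exact h (by rw [key]; simp)
  by_cases hA : A = ⊤
  · rw [htop.2 hA, hA, EReal.coe_ennreal_top]
    change (⊤ : EReal) - ((B' : ℝ) : EReal) = ⊤ - ((B : ℝ) : EReal) - _
    simp
  · lift A' to ℝ≥0 using fun h => hA (htop.1 h)
    lift A to ℝ≥0 using hA
    have hreal := congrArg ENNReal.toReal key
    simp only [ENNReal.toReal_add, ENNReal.ofReal_ne_top, ENNReal.coe_ne_top, ne_eq,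
      not_false_eq_true, ENNReal.add_eq_top, or_self, ENNReal.toReal_ofReal',
      ENNReal.coe_toReal] at hreal
    change ((A' : ℝ) : EReal) - ((B' : ℝ) : EReal) = ((A : ℝ) : EReal) - ((B : ℝ) : EReal) - _
    rw [← EReal.coe_sub, ← EReal.coe_sub, ← EReal.coe_sub, EReal.coe_eq_coe_iff]
    linarith [max_zero_sub_max_neg_zero_eq_self (Real.log c)]

theorem logEnergy_image_affine {K : Set ℝ} (hK : IsCompact K) :
    logEnergy (affineMeasurableEquiv c e hc '' K) = logEnergy K - (Real.log c : ℝ) := by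
  unfold logEnergy
  rw [iInf_isProbOn_affine]
  refine le_antisymm ?_ (le_iInf₂ fun ν hν => ?_)
  · rw [EReal.le_sub_iff_add_le (by simp) (by simp)]
    refine le_iInf₂ fun ν hν => EReal.add_le_of_le_sub ?_
    rw [← logMeasureEnergy_map_affine (e := e) hc hK hν]
    exact iInf₂_le ν hν
  · rw [logMeasureEnergy_map_affine hc hK hν]
    exact EReal.sub_le_sub (iInf₂_le ν hν) le_rfl

/-- The Riesz capacity is homogeneous of degree one and translation invariant. -/
theorem rieszCap_image_affine (p : ℝ) {K : Set ℝ} (hK : IsCompact K) :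
    rieszCap p (affineMeasurableEquiv c e hc '' K) = ENNReal.ofReal c * rieszCap p K := by
  unfold rieszCap
  split_ifs with hp
  · rw [logEnergy_image_affine hc hK, EReal.neg_sub (by simp) (by simp), EReal.exp_add,
      EReal.exp_coe, Real.exp_log hc, mul_comm]
  · obtain ⟨h0, ht⟩ := ofReal_rpow_ne_zero_ne_top hc (-p)
    rw [rieszEnergy_image_affine, mul_rpow_of_ne_zero_ne_top h0 ht, ← ENNReal.rpow_mul]
    congr 1
    rw [show -p * (-1 / p) = 1 by field_simp, ENNReal.rpow_one]

end Affine

theorem image_affine_Icc_zero_one {c e : ℝ} (hc : 0 < c) :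
    affineMeasurableEquiv c e hc '' Set.Icc 0 1 = Set.Icc e (c + e) := by
  change (fun x => c * x + e) '' Set.Icc 0 1 = _
  simpa using Set.image_affine_Icc' hc e 0 1

/-! ### Normalization and the case `p ≤ -1` -/

/-- Every compact set with more than one point is an affine copy of a compact set whose convex
hull is `[0, 1]`. -/
theorem exists_affine_normalization {K : Set ℝ} (hK : IsCompact K) (hnt : K.Nontrivial) :
    ∃ (c e : ℝ) (hc : 0 < c) (L : Set ℝ), IsCompact L ∧ L ⊆ Set.Icc 0 1 ∧ 0 ∈ L ∧ 1 ∈ L ∧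
      K = affineMeasurableEquiv c e hc '' L ∧ Metric.ediam K = ENNReal.ofReal c := by
  obtain ⟨a, haK, ha⟩ := hK.exists_isLeast hnt.nonempty
  obtain ⟨b, hbK, hb⟩ := hK.exists_isGreatest hnt.nonempty
  have hab : a < b := by
    obtain ⟨x, hx, y, hy, hxy⟩ := hnt
    rcases hxy.lt_or_gt with h | h
    · exact (ha hx).trans_lt (h.trans_le (hb hy))
    · exact (ha hy).trans_lt (h.trans_le (hb hx))
  have hc : 0 < b - a := sub_pos.2 hab
  refine ⟨b - a, a, hc, affineMeasurableEquiv (b - a) a hc ⁻¹' K, ?_, ?_, ?_, ?_, ?_, ?_⟩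
  · exact (affineHomeomorph (b - a) a hc.ne').isCompact_preimage.2 hK
  · intro x (hx : (b - a) * x + a ∈ K)
    have h1 := ha hx
    have h2 := hb hx
    exact ⟨by by_contra! h; nlinarith, by by_contra! h; nlinarith⟩
  · change (b - a) * 0 + a ∈ K
    simpa using haK
  · change (b - a) * 1 + a ∈ K
    simpa using hbK
  · rw [Set.image_preimage_eq _ (affineMeasurableEquiv (b - a) a hc).surjective]
  · refine le_antisymm ?_ ?_
    · rw [← Real.ediam_Icc]
      exact Metric.ediam_mono fun x hx => ⟨ha hx, hb hx⟩
    · have := Metric.edist_le_ediam_of_mem hbK haK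
      rwa [edist_dist, Real.dist_eq, abs_of_pos hc] at this

theorem lintegral_ofReal_affine {μ : Measure ℝ} [IsProbabilityMeasure μ]
    (hμ : Integrable (fun x => x) μ) (a b : ℝ) (h : ∀ᵐ x ∂μ, 0 ≤ a + b * x) :
    ∫⁻ x, ENNReal.ofReal (a + b * x) ∂μ = ENNReal.ofReal (a + b * ∫ x, x ∂μ) := by
  have hint : Integrable (fun x => a + b * x) μ := (integrable_const a).add (hμ.const_mul b)
  rw [← ofReal_integral_eq_lintegral_ofReal hint h,
    integral_add (integrable_const a) (hμ.const_mul b), integral_const_mul]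
  simp

/-- For `p ≤ -1` the endpoints carry the measure of maximal energy. -/
theorem rieszEnergy_of_le_neg_one {p : ℝ} (hp : p ≤ -1) {L : Set ℝ} (hL : MeasurableSet L)
    (hL01 : L ⊆ Set.Icc 0 1) (h0 : 0 ∈ L) (h1 : 1 ∈ L) : rieszEnergy p L = 2⁻¹ := by
  have hp0 : 0 < -p := by linarith
  rw [rieszEnergy, if_neg (by linarith)]
  refine le_antisymm (iSup₂_le fun μ hμL => ?_) ?_
  · have hμ := hμL.mono hL01
    have := hμ.1
    have hae : ∀ᵐ y ∂μ, y ∈ Set.Icc (0 : ℝ) 1 := by rw [ae_iff]; exact hμ.2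
    have hint : Integrable (fun x : ℝ => x) μ := by
      refine Integrable.of_bound measurable_id.aestronglyMeasurable 1 (hae.mono fun x hx => ?_)
      rw [Real.norm_eq_abs, abs_le]
      exact ⟨by linarith [hx.1], hx.2⟩
    set m := ∫ x, x ∂μ with hm
    have hm0 : 0 ≤ m := integral_nonneg_of_ae (hae.mono fun x hx => hx.1)
    have hm1 : m ≤ 1 := by
      have := integral_mono_ae hint (integrable_const (1 : ℝ)) (hae.mono fun x hx => hx.2)
      simpa using this
    -- As `-p ≥ 1` and `|x - y| ≤ 1`, the kernel is at most `|x - y| ≤ x(1 - y) + y(1 - x)`. This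
    -- bound is affine in each variable, so its double integral is `2m(1 - m) ≤ 1/2`, with `m` the
    -- mean.
    have hker : ∀ x ∈ Set.Icc (0 : ℝ) 1, ∀ y ∈ Set.Icc (0 : ℝ) 1,
        ENNReal.ofReal |x - y| ^ (-p) ≤ ENNReal.ofReal (x + (1 - 2 * x) * y) := by
      intro x ⟨hx0, hx1⟩ y ⟨hy0, hy1⟩
      have h1 : |x - y| ≤ x + (1 - 2 * x) * y := by
        rw [abs_le]
        constructor <;> nlinarith [mul_nonneg hx0 (sub_nonneg.2 hy1),
          mul_nonneg hy0 (sub_nonneg.2 hx1)]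
      refine le_trans ?_ (ENNReal.ofReal_le_ofReal h1)
      refine ENNReal.rpow_le_self_of_le_one ?_ (by linarith)
      rw [← ENNReal.ofReal_one]
      exact ENNReal.ofReal_le_ofReal (abs_le.2 ⟨by linarith, by linarith⟩)
    calc rieszMeasureEnergy p μ
        ≤ ∫⁻ x, ENNReal.ofReal (m + (1 - 2 * m) * x) ∂μ := by
          refine lintegral_mono_ae (hae.mono fun x hx => ?_)
          refine (lintegral_mono_ae (hae.mono fun y hy => hker x hx y hy)).trans_eq ?_
          rw [lintegral_ofReal_affine hint _ _ (hae.mono fun y hy => ?_), ← hm]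
          · congr 1; ring
          · nlinarith [mul_nonneg hx.1 (sub_nonneg.2 hy.2), mul_nonneg hy.1 (sub_nonneg.2 hx.2)]
      _ = ENNReal.ofReal (m + (1 - 2 * m) * m) := by
          rw [lintegral_ofReal_affine hint _ _ (hae.mono fun y hy => ?_)]
          nlinarith [mul_nonneg hm0 (sub_nonneg.2 hy.2), mul_nonneg hy.1 (sub_nonneg.2 hm1)]
      _ ≤ ENNReal.ofReal 2⁻¹ := ENNReal.ofReal_le_ofReal (by nlinarith [sq_nonneg (2 * m - 1)])
      _ = 2⁻¹ := by rw [ENNReal.ofReal_inv_of_pos two_pos]; simp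
  -- Equality holds for `(δ₀ + δ₁) / 2`: the diagonal contributes `0`, the cross terms `2 · 1/4`.
  · have hμ := (IsProbOn.dirac hL h0).combination (IsProbOn.dirac hL h1)
      (a := 2⁻¹) (t := 2⁻¹) (by ext; norm_num)
    refine le_trans (le_of_eq ?_) (le_iSup₂ (f := fun (μ : Measure ℝ) (_ : IsProbOn L μ) =>
      rieszMeasureEnergy p μ) _ hμ)
    change _ = mutualEnergy (fun r => ENNReal.ofReal r ^ (-p)) _ _
    rw [mutualEnergy_combination (by fun_prop)]
    have hmeas : ∀ x : ℝ, Measurable fun y : ℝ => ENNReal.ofReal |x - y| ^ (-p) := fun x => by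
      fun_prop
    simp only [mutualEnergy, lintegral_dirac, sub_self, abs_zero, ENNReal.ofReal_zero,
      ENNReal.zero_rpow_of_pos hp0, mul_zero, zero_sub, abs_neg, abs_one, ENNReal.ofReal_one,
      ENNReal.one_rpow, mul_one, add_zero, zero_add]
    rw [ENNReal.coe_inv two_ne_zero, ENNReal.coe_ofNat, ← mul_assoc,
      ENNReal.mul_inv_cancel two_ne_zero ENNReal.ofNat_ne_top, one_mul]

/-! ### The main theorem -/

theorem mainTheorem9 (q : ℝ) (hq₁ : -1 < q) (hq₂ : q < 1) :
    (∀ p : ℝ, p ≤ -1 → ∀ K : Set ℝ, IsCompact K → K.Nontrivial →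
      (0 < rieszCap p K ∧ rieszCap p K < ⊤ ∧ rieszCap q K < ⊤) ∧
      (IsMaxOn (fun L : Set ℝ => rieszCap q L / rieszCap p L)
          {L : Set ℝ | IsCompact L ∧ L.Nontrivial} K ↔
        ∃ a b : ℝ, a < b ∧ K = Set.Icc a b)) ∧
    (∀ K : Set ℝ, IsCompact K → K.Nontrivial →
      rieszCap q K ≤ rieszCap q (Set.Icc (-1) 1) / 2 * Metric.ediam K ∧
      (rieszCap q K = rieszCap q (Set.Icc (-1) 1) / 2 * Metric.ediam K ↔
        ∃ a b : ℝ, a < b ∧ K = Set.Icc a b)) := by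
  have hC1 := (rieszCap_Icc_zero_one_le_one q).trans_lt ENNReal.one_lt_top
  have hhalf : rieszCap q (Set.Icc (-1) 1) / 2 = rieszCap q (Set.Icc 0 1) := by
    have h := rieszCap_image_affine (e := -1) two_pos q (isCompact_Icc (a := (0 : ℝ)) (b := 1))
    rw [image_affine_Icc_zero_one] at h
    rw [show (1 : ℝ) = 2 + -1 by norm_num, show -(2 + -1 : ℝ) = -1 by norm_num, h,
      show (2 + -1 : ℝ) = 1 by norm_num, ENNReal.ofReal_ofNat, mul_comm,
      ENNReal.mul_div_cancel_right two_ne_zero ENNReal.ofNat_ne_top]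
  have hIcc : ∀ a b : ℝ, a < b → ∃ hc : 0 < b - a,
      Set.Icc a b = affineMeasurableEquiv (b - a) a hc '' Set.Icc 0 1 := fun a b hab =>
    ⟨sub_pos.2 hab, by rw [image_affine_Icc_zero_one]; simp⟩
  have hdiam : ∀ K : Set ℝ, IsCompact K → K.Nontrivial →
      Metric.ediam K ≠ 0 ∧ Metric.ediam K ≠ ⊤ := fun K hK hnt => by
    obtain ⟨c, e, hc, L, -, -, -, -, -, hd⟩ := exists_affine_normalization hK hnt
    rw [hd]
    exact ⟨(ENNReal.ofReal_pos.2 hc).ne', ENNReal.ofReal_ne_top⟩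
  have hmain : ∀ K : Set ℝ, IsCompact K → K.Nontrivial →
      rieszCap q K ≤ rieszCap q (Set.Icc 0 1) * Metric.ediam K ∧
      (rieszCap q K = rieszCap q (Set.Icc 0 1) * Metric.ediam K ↔
        ∃ a b : ℝ, a < b ∧ K = Set.Icc a b) := by
    intro K hK hnt
    obtain ⟨c, e, hc, L, hL, hL01, h0, h1, rfl, hd⟩ := exists_affine_normalization hK hnt
    have hc' := (ENNReal.ofReal_pos.2 hc).ne'
    rw [hd, rieszCap_image_affine hc q hL, mul_comm]
    by_cases hne : L = Set.Icc 0 1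
    · subst hne
      refine ⟨le_rfl, iff_of_true rfl ⟨e, c + e, by linarith, image_affine_Icc_zero_one hc⟩⟩
    · have hlt := rieszCap_lt_of_ne hq₁ hq₂ hL hL01 h0 h1 hne
      have hlt' := (ENNReal.mul_lt_mul_iff_left hc' ENNReal.ofReal_ne_top).2 hlt
      refine ⟨hlt'.le, iff_of_false hlt'.ne ?_⟩
      rintro ⟨a, b, hab, heq⟩
      -- If the image of `L` is an interval, it contains all points between the images of `0` and
      -- `1`, so `L` is all of `[0, 1]`.
      refine hne (hL01.antisymm fun x hx => ?_)
      have hmem : ∀ y, affineMeasurableEquiv c e hc y ∈ Set.Icc a b ↔ y ∈ L := fun y => by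
        rw [← heq, (affineMeasurableEquiv c e hc).injective.mem_set_image]
      rw [← hmem]
      have ha := (hmem 0).2 h0
      have hb := (hmem 1).2 h1
      simp only [affineMeasurableEquiv_apply, Set.mem_Icc] at *
      constructor <;> nlinarith
  have hp : ∀ p : ℝ, p ≤ -1 → ∀ K : Set ℝ, IsCompact K → K.Nontrivial →
      rieszCap p K = (2⁻¹ : ℝ≥0∞) ^ (-1 / p) * Metric.ediam K := by
    intro p hp K hK hnt
    obtain ⟨c, e, hc, L, hL, hL01, h0, h1, rfl, hd⟩ := exists_affine_normalization hK hnt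
    rw [hd, rieszCap_image_affine hc p hL, rieszCap, if_neg (by linarith),
      rieszEnergy_of_le_neg_one hp hL.measurableSet hL01 h0 h1, mul_comm]
  refine ⟨fun p hp1 K hK hnt => ?_, fun K hK hnt => by rw [hhalf]; exact hmain K hK hnt⟩
  have hk0 : (2⁻¹ : ℝ≥0∞) ^ (-1 / p) ≠ 0 := (ENNReal.rpow_pos (by simp) (by simp)).ne'
  have hkt : (2⁻¹ : ℝ≥0∞) ^ (-1 / p) ≠ ⊤ :=
    ENNReal.rpow_ne_top_of_nonneg (div_nonneg_of_nonpos (by norm_num) (by linarith)) (by simp)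
  have hcap : ∀ L : Set ℝ, IsCompact L → L.Nontrivial →
      rieszCap p L ≠ 0 ∧ rieszCap p L ≠ ⊤ := fun L hL hLnt => by
    rw [hp p hp1 L hL hLnt]
    exact ⟨mul_ne_zero hk0 (hdiam L hL hLnt).1, ENNReal.mul_ne_top hkt (hdiam L hL hLnt).2⟩
  -- Since `cap_p` is proportional to the diameter, the diameter bound is a bound on the ratio.
  have hratio : ∀ L : Set ℝ, IsCompact L → L.Nontrivial →
      rieszCap q (Set.Icc 0 1) * Metric.ediam L =
        rieszCap q (Set.Icc 0 1) / (2⁻¹ : ℝ≥0∞) ^ (-1 / p) * rieszCap p L := by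
    intro L hL hLnt
    rw [hp p hp1 L hL hLnt, ← mul_assoc, ENNReal.div_mul_cancel hk0 hkt]
  refine ⟨⟨(hcap K hK hnt).1.bot_lt, (hcap K hK hnt).2.lt_top,
    (hmain K hK hnt).1.trans_lt (ENNReal.mul_lt_top hC1 (hdiam K hK hnt).2.lt_top)⟩, ?_⟩
  rw [← (hmain K hK hnt).2, hratio K hK hnt]
  have heqiff : ∀ L : Set ℝ, IsCompact L → L.Nontrivial →
      (rieszCap q L = rieszCap q (Set.Icc 0 1) / (2⁻¹ : ℝ≥0∞) ^ (-1 / p) * rieszCap p L ↔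
        rieszCap q L / rieszCap p L =
          rieszCap q (Set.Icc 0 1) / (2⁻¹ : ℝ≥0∞) ^ (-1 / p)) := fun L hL hLnt => by
    rw [eq_comm (a := rieszCap q L / _), ENNReal.eq_div_iff (hcap L hL hLnt).1 (hcap L hL hLnt).2,
      mul_comm, eq_comm]
  have hle : ∀ L : Set ℝ, IsCompact L → L.Nontrivial →
      rieszCap q L / rieszCap p L ≤
        rieszCap q (Set.Icc 0 1) / (2⁻¹ : ℝ≥0∞) ^ (-1 / p) := fun L hL hLnt => by
    refine ENNReal.div_le_of_le_mul ?_
    rw [← hratio L hL hLnt]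
    exact (hmain L hL hLnt).1
  rw [heqiff K hK hnt]
  constructor
  -- A maximizer is compared with `[0, 1]`, where the bound is attained.
  · intro hmax
    have hI : IsCompact (Set.Icc (0 : ℝ) 1) := isCompact_Icc
    have hInt : (Set.Icc (0 : ℝ) 1).Nontrivial :=
      ⟨0, by simp, 1, by simp, zero_ne_one⟩
    refine le_antisymm (hle K hK hnt) ?_
    rw [← (heqiff _ hI hInt).1 ?_]
    · exact hmax ⟨hI, hInt⟩
    · rw [← hratio _ hI hInt, (hmain _ hI hInt).2]
      exact ⟨0, 1, one_pos, rfl⟩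
  · intro heq L hL
    change rieszCap q L / rieszCap p L ≤ rieszCap q K / rieszCap p K
    rw [heq]
    exact hle L hL.1 hL.2
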